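/- Let $p$ be a prime, let $n\ge 0$ be an integer, and let $\mathcal F$ be a family of subsets of $[n]=\{1,\dots,n\}$ that is $(p+1)$-wise $p$-divisible, i.e. $|A_1\cap\cdots\cap A_{p+1}|$ is divisible by $p$ for any (not necessarily distinct) $A_1,\dots,A_{p+1}\in\mathcal F$. If $|\mathcal F|>2^{\lfloor n/p\rfloor-1}$, then $\mathcal F$ is contained in an atomic family with atoms of size $p$; that is, there are pairwise disjoint sets $B_1,\dots,B_m\subseteq[n]$ (with $m\ge 0$), each of cardinality $p$, such that $\mathcal F$ is contained in the family of all unions $\bigcup_{i\in I}B_i$, $I\subseteq\{1,\dots,m\}$ (the empty union $\varnothing$ included). -/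

import Mathlib

/-- A family `F` of subsets of an `n`-element set is `k`-wise `l`-divisible if
`|A₁ ∩ ⋯ ∩ A_k|` is divisible by `l` for any, not necessarily distinct,
`A₁, …, A_k ∈ F`. -/
def IsWiseDivisible {n : ℕ} (k l : ℕ) (F : Finset (Finset (Fin n))) : Prop :=
  ∀ A : Fin k → Finset (Fin n), (∀ i, A i ∈ F) → l ∣ (Finset.univ.inf A).card

/-- `G` is the atomic family with set of atoms `atoms`: the atoms are pairwise disjoint, and
`G` consists of all the unions of atoms (the empty union `∅` included). -/
def IsAtomicFamily {n : ℕ} (G atoms : Finset (Finset (Fin n))) : Prop :=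
  (∀ A ∈ atoms, ∀ B ∈ atoms, A ≠ B → Disjoint A B) ∧
    ∀ S : Finset (Fin n), S ∈ G ↔ ∃ B ⊆ atoms, S = B.sup id

/-! Let `E` be the union of `F` and `V` the span of the indicators of `F` over an infinite field of
characteristic `p`. Products of indicators are indicators of intersections, so divisibility says
that every function in `V ^ (p + 1)` has sum zero. The key dichotomy is: `F` consists of unions of
disjoint blocks of sizes divisible by `p`, or `p * dim V + p ≤ |E|`.

If multiplication by the indicator of some proper nonempty `S ⊆ E` preserves `V ^ (p + 1)`, then the
traces of `F` on `S` and on its complement inherit the zero-sum condition, and induction on `|E|`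
applies. Otherwise a Kneser-type theorem gives `(p + 1) * dim V ≤ |E| + p`, which suffices for `dim
V ≥ 2p`. For smaller `dim V`, a nontrivial member of `F` forces `V ^ (p + 2)` to exceed `V ^ (p +
1)`, whence `2 ^ (p + 2) ≤ |E| + 1`, again enough. With no nontrivial member, `E` is the only block.

Since `|F| ≤ 2 ^ dim V`, the second alternative contradicts the size of `F`. In the first, `F` has
at least `⌊n/p⌋` blocks, which leaves no room for one larger than `p`. -/

open Module

/-! ### Kneser-type bounds for products of function spaces. -/

section ProductSpaces

variable {K α : Type*} [Field K]

/-- The functions that vanish outside `E`. -/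
def functionsOn (K : Type*) {α : Type*} [Field K] (E : Finset α) : Submodule K (α → K) where
  carrier := {f | ∀ x ∉ E, f x = 0}
  add_mem' hf hg x hx := by simp [hf x hx, hg x hx]
  zero_mem' _ _ := rfl
  smul_mem' c f hf x hx := by simp [hf x hx]

/-- No point of `E` is a common zero of `V`. -/
def NoCommonZero (V : Submodule K (α → K)) (E : Finset α) : Prop :=
  ∀ x ∈ E, ∃ f ∈ V, f x ≠ 0

/-- The indicator function of a finite set, with values in `K`. -/
def ind (K : Type*) {α : Type*} [Field K] [DecidableEq α] (A : Finset α) : α → K :=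
  fun x => if x ∈ A then 1 else 0

/-- `V` contains the product of each of its members with the indicator function of `S`. -/
def Stabilizes [DecidableEq α] (S : Finset α) (V : Submodule K (α → K)) : Prop :=
  ∀ f ∈ V, ind K S * f ∈ V

theorem exists_mem_forall_notMem [Infinite K] {X ι : Type*} [AddCommGroup X] [Module K X]
    (V : Submodule K X) (s : Finset ι) (U : ι → Submodule K X) (hU : ∀ i ∈ s, ¬ V ≤ U i) :
    ∃ v ∈ V, ∀ i ∈ s, v ∉ U i := by
  classical
  have h := Subspace.biUnion_ne_univ_of_top_notMem (k := K) (E := V)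
    (s := s.image fun i => (U i).comap V.subtype) (by
      intro ht
      obtain ⟨i, hi, hi'⟩ := Finset.mem_image.1 ht
      refine hU i hi fun v hv => ?_
      have : (⟨v, hv⟩ : V) ∈ (U i).comap V.subtype := hi' ▸ Submodule.mem_top
      exact this)
  obtain ⟨v, hv⟩ := (Set.ne_univ_iff_exists_notMem _).1 h
  refine ⟨v, v.2, fun i hi hvi => hv ?_⟩
  simp only [Set.mem_iUnion]
  exact ⟨_, Finset.mem_image_of_mem _ hi, hvi⟩

theorem exists_mem_ne_zero_forall_notMem [Infinite K] {ι : Type*} {E : Finset α}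
    {V : Submodule K (α → K)} (hV : NoCommonZero V E) (s : Finset ι)
    (U : ι → Submodule K (α → K)) (hU : ∀ i ∈ s, ¬ V ≤ U i) :
    ∃ v ∈ V, (∀ x ∈ E, v x ≠ 0) ∧ ∀ i ∈ s, v ∉ U i := by
  obtain ⟨v, hv, h⟩ := exists_mem_forall_notMem V (E.disjSum s)
    (Sum.elim (fun x => LinearMap.ker (LinearMap.proj (R := K) (φ := fun _ : α => K) x)) U) (by
      rintro (x | i) hi hle
      · obtain ⟨f, hf, hfx⟩ := hV x (by simpa using hi)
        exact hfx (by simpa using hle hf)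
      · exact hU i (by simpa using hi) hle)
  refine ⟨v, hv, fun x hx h0 => h (Sum.inl x) (by simpa using hx) (by simpa using h0), ?_⟩
  exact fun i hi => h (Sum.inr i) (by simpa using hi)

theorem finrank_le_finrank_map_mul [Finite α] {E : Finset α} {V : Submodule K (α → K)}
    (hV : V ≤ functionsOn K E) {b : α → K} (hb : ∀ x ∈ E, b x ≠ 0) :
    finrank K V ≤ finrank K (V.map (LinearMap.mulLeft K b)) := by
  have h : V ≤ (V.map (LinearMap.mulLeft K b)).map (LinearMap.mulLeft K b⁻¹) := by
    intro f hf
    refine ⟨b * f, ⟨f, hf, rfl⟩, ?_⟩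
    funext x
    by_cases hx : x ∈ E
    · simp [hb x hx]
    · simp [hV hf x hx]
  exact (Submodule.finrank_mono h).trans (Submodule.finrank_map_le _ _)

/-- Dyson's transform shows that `A * B` contains a large subspace around `B`, or one that is
stable under multiplication by a function that is not constant on `E`. -/
theorem exists_large_or_stable_subspace [Finite α] [Infinite K] [DecidableEq α]
    {E : Finset α}
    (A : Submodule K (α → K)) : ∀ B : Submodule K (α → K),
    A ≤ functionsOn K E → B ≤ functionsOn K E → ind K E ∈ A → NoCommonZero B E →
    ∃ M, B ≤ M ∧ M ≤ A * B ∧ (finrank K A + finrank K B ≤ finrank K M + 1 ∨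
      ∃ f : α → K, (∃ x ∈ E, ∃ y ∈ E, f x ≠ f y) ∧ ∀ m ∈ M, f * m ∈ M) := by
  induction hd : finrank K A using Nat.strong_induction_on generalizing A with
  | _ d ih =>
  intro B hA hB h1 hfull
  have hone : ∀ f ∈ functionsOn K E, ind K E * f = f := by
    intro f hf
    funext x
    by_cases hx : x ∈ E
    · simp [ind, hx]
    · simp [ind, hx, hf x hx]
  have hBAB : B ≤ A * B := fun f hf => by
    have := Submodule.mul_mem_mul h1 hf
    rwa [hone f (hB hf)] at this
  by_cases hstab : ∀ b ∈ B, (∀ x ∈ E, b x ≠ 0) → ∀ a ∈ A, b * a ∈ B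
  · have hAB : ∀ a ∈ A, ∀ b ∈ B, a * b ∈ B := by
      intro a ha
      by_contra! hcon
      obtain ⟨b₀, hb₀, hb₀'⟩ := hcon
      -- If multiplication by `a` takes one element of `B` out of `B`, it does so for a generic one,
      -- which also vanishes nowhere on `E`.
      obtain ⟨b, hb, hne, hnot⟩ := exists_mem_ne_zero_forall_notMem hfull
        ({()} : Finset Unit) (fun _ => B.comap (LinearMap.mulLeft K a))
        (fun _ _ hle => hb₀' (hle hb₀))
      refine hnot () (by simp) ?_
      have := hstab b hb hne a ha
      rwa [mul_comm] at this
    refine ⟨B, le_rfl, hBAB, ?_⟩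
    by_cases hc : ∃ f ∈ A, ∃ x ∈ E, ∃ y ∈ E, f x ≠ f y
    · obtain ⟨f, hf, hxy⟩ := hc
      exact Or.inr ⟨f, hxy, fun m hm => hAB f hf m hm⟩
    · left
      push Not at hc
      have hle : A ≤ Submodule.span K {ind K E} := by
        intro f hf
        rw [Submodule.mem_span_singleton]
        rcases E.eq_empty_or_nonempty with rfl | ⟨y, hy⟩
        · exact ⟨0, by funext x; simp [hA hf x (by simp)]⟩
        · refine ⟨f y, ?_⟩
          funext x
          by_cases hx : x ∈ E
          · simp [ind, hx, hc f hf x hx y hy]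
          · simp [ind, hx, hA hf x hx]
      have := (Submodule.finrank_mono hle).trans (finrank_span_le_card (R := K) {ind K E})
      rw [Set.toFinset_singleton, Finset.card_singleton] at this
      omega
  · push Not at hstab
    obtain ⟨b, hb, hne, a, ha, hab⟩ := hstab
    -- The transform replaces `(A, B)` by `(A ∩ b⁻¹B, B + bA)`. The product does not leave `A * B`
    -- because `b * A' ≤ B`; the sum of dimensions does not drop because `b` is invertible on `E`
    -- and `B ∩ bA = b * A'`.
    set A' := A ⊓ B.comap (LinearMap.mulLeft K b) with hA'
    set bA := A.map (LinearMap.mulLeft K b) with hbA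
    have hlt : finrank K A' < d := by
      rw [← hd]
      refine Submodule.finrank_lt_finrank_of_lt (lt_of_le_of_ne inf_le_left fun h => hab ?_)
      have : a ∈ A' := h ▸ ha
      exact this.2
    have hbAE : bA ≤ functionsOn K E := by
      rintro _ ⟨f, hf, rfl⟩ x hx
      simp [hA hf x hx]
    obtain ⟨M, hM₁, hM₂, hM₃⟩ := ih _ hlt A' rfl (B ⊔ bA) (inf_le_left.trans hA)
      (sup_le hB hbAE) ⟨h1, by
        show b * ind K E ∈ B
        rw [mul_comm, hone b (hB hb)]
        exact hb⟩
      (fun x hx => (hfull x hx).imp fun f hf => ⟨Submodule.mem_sup_left hf.1, hf.2⟩)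
    refine ⟨M, le_sup_left.trans hM₁, hM₂.trans ?_, hM₃.imp_left fun h => ?_⟩
    · rw [Submodule.mul_sup, sup_le_iff]
      refine ⟨mul_le_mul_left inf_le_left B, Submodule.mul_le.2 ?_⟩
      rintro u hu _ ⟨v, hv, rfl⟩
      have hbu : b * u ∈ B := hu.2
      have := Submodule.mul_mem_mul hv hbu
      rw [LinearMap.mulLeft_apply]
      rwa [show u * (b * v) = v * (b * u) by ring]
    · have h₁ := Submodule.finrank_sup_add_finrank_inf_eq B bA
      have h₂ : finrank K (B ⊓ bA : Submodule K (α → K)) ≤ finrank K A' := by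
        refine (Submodule.finrank_mono ?_).trans
          (Submodule.finrank_map_le (LinearMap.mulLeft K b) A')
        rintro _ ⟨hf, ⟨u, hu, rfl⟩⟩
        exact ⟨u, ⟨hu, hf⟩, rfl⟩
      have h₃ := finrank_le_finrank_map_mul hA hne
      rw [← hbA] at h₃
      omega

/-- A level set of a multiplier of `M` stabilizes `M`. -/
theorem stabilizes_levelSet [DecidableEq α] [DecidableEq K] {E : Finset α}
    {M : Submodule K (α → K)} (hM : M ≤ functionsOn K E) {f : α → K}
    (hf : ∀ m ∈ M, f * m ∈ M) (c : K) : Stabilizes (E.filter fun x => f x = c) M := by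
  -- Lagrange interpolation: taken over all values of `f` on `E` other than `c`, this polynomial in
  -- `f` is the indicator of the level set.
  have key : ∀ s : Finset K, ∀ m ∈ M,
      (fun x => ∏ v ∈ s, (c - v)⁻¹ * (f x - v)) * m ∈ M := by
    intro s
    induction s using Finset.induction_on with
    | empty => intro m hm; convert hm using 1; funext x; simp
    | insert v s hv ih =>
      intro m hm
      have := M.smul_mem (c - v)⁻¹
        (M.sub_mem (hf _ (ih m hm)) (M.smul_mem v (ih m hm)))
      convert this using 1
      funext x
      simp [Finset.prod_insert hv]
      ring
  intro m hm
  convert key ((E.image f).erase c) m hm using 1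
  funext x
  by_cases hx : x ∈ E
  · by_cases hc : f x = c
    · simp only [Pi.mul_apply, ind, Finset.mem_filter, hx, hc, and_self, if_true]
      congr 1
      refine (Finset.prod_eq_one fun v hv => ?_).symm
      exact inv_mul_cancel₀ (sub_ne_zero.2 (Finset.ne_of_mem_erase hv).symm)
    · simp only [Pi.mul_apply, ind, Finset.mem_filter, hx, hc, and_false, if_false]
      rw [Finset.prod_eq_zero (i := f x)]
      · exact Finset.mem_erase.2 ⟨hc, Finset.mem_image_of_mem _ hx⟩
      · simp
  · simp [hM hm x hx]

theorem mul_le_functionsOn {E : Finset α} {V W : Submodule K (α → K)}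
    (hV : V ≤ functionsOn K E) : V * W ≤ functionsOn K E :=
  Submodule.mul_le.2 fun f hf g _ x hx => by simp [hV hf x hx]

/-- A form of Kneser's theorem for products of spaces of functions. -/
theorem finrank_add_finrank_le_or_exists_stabilizes [Finite α] [Infinite K] [DecidableEq α]
    {E : Finset α}
    {V W : Submodule K (α → K)} (hV : V ≤ functionsOn K E) (hW : W ≤ functionsOn K E)
    (hV0 : NoCommonZero V E) (hW0 : NoCommonZero W E) :
    finrank K V + finrank K W ≤ finrank K (V * W : Submodule K (α → K)) + 1 ∨
      ∃ S ⊆ E, S.Nonempty ∧ S ≠ E ∧ Stabilizes S (V * W) := by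
  classical
  by_contra! hcon
  obtain ⟨hdim, hno⟩ := hcon
  -- If `V ≤ U S`, then `S` stabilizes `V * W`. So a generic `a ∈ V` avoids `U S` for all proper
  -- nonempty `S` at once.
  let U : Finset α → Submodule K (α → K) := fun S =>
    { carrier := {a | ∀ w ∈ W, ind K S * (a * w) ∈ V * W}
      add_mem' := fun {a b} ha hb w hw => by
        rw [add_mul, mul_add]
        exact Submodule.add_mem _ (ha w hw) (hb w hw)
      zero_mem' := fun w _ => by simp
      smul_mem' := fun c a ha w hw => by
        rw [smul_mul_assoc, mul_smul_comm]
        exact Submodule.smul_mem _ _ (ha w hw) }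
  obtain ⟨a, ha, hne, hnot⟩ := exists_mem_ne_zero_forall_notMem hV0
    (E.powerset.filter fun S => S.Nonempty ∧ S ≠ E) U (by
      intro S hS hle
      simp only [Finset.mem_filter, Finset.mem_powerset] at hS
      refine hno S hS.1 hS.2.1 hS.2.2 fun f hf => ?_
      induction hf using Submodule.mul_induction_on' with
      | mem_mul_mem v hv w hw => exact hle hv w hw
      | add f _ g _ hf hg => rw [mul_add]; exact Submodule.add_mem _ hf hg)
  have hcancel : ∀ f ∈ functionsOn K E, a⁻¹ * (a * f) = f := by
    intro f hf
    funext x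
    by_cases hx : x ∈ E
    · simp [hne x hx]
    · simp [hf x hx]
  -- Passing to `a⁻¹V` and `aW` puts the indicator of `E` in the first factor without enlarging the
  -- product. A level set stabilizing `M ⊇ aW` would put `a` in some `U S`.
  obtain ⟨M, hM₁, hM₂, hM₃⟩ := exists_large_or_stable_subspace (E := E)
    (V.map (LinearMap.mulLeft K a⁻¹)) (W.map (LinearMap.mulLeft K a))
    (by rintro _ ⟨f, hf, rfl⟩ x hx; simp [hV hf x hx])
    (by rintro _ ⟨f, hf, rfl⟩ x hx; simp [hW hf x hx])
    ⟨a, ha, by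
      funext x
      by_cases hx : x ∈ E
      · simp [ind, hx, hne x hx]
      · simp [ind, hx, hV ha x hx]⟩
    (fun x hx => by
      obtain ⟨w, hw, hwx⟩ := hW0 x hx
      exact ⟨_, ⟨w, hw, rfl⟩, by simp [hne x hx, hwx]⟩)
  have hMle : M ≤ V * W := by
    refine hM₂.trans (Submodule.mul_le.2 ?_)
    rintro _ ⟨v, hv, rfl⟩ _ ⟨w, hw, rfl⟩
    have := Submodule.mul_mem_mul hv hw
    rw [← hcancel w (hW hw)] at this
    simp only [LinearMap.mulLeft_apply]
    rwa [show a⁻¹ * v * (a * w) = v * (a⁻¹ * (a * w)) by ring]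
  rcases hM₃ with h | ⟨f, ⟨x, hx, y, hy, hxy⟩, hf⟩
  · have h₁ := finrank_le_finrank_map_mul (b := a⁻¹) hV (fun x hx => by simpa using hne x hx)
    have h₂ := finrank_le_finrank_map_mul hW hne
    have h₃ := Submodule.finrank_mono hMle
    omega
  · have hstab := stabilizes_levelSet (hMle.trans (mul_le_functionsOn hV)) hf (f x)
    refine hnot (E.filter fun z => f z = f x) ?_ fun w hw => hMle (hstab _ (hM₁ ⟨w, hw, rfl⟩))
    simp only [Finset.mem_filter, Finset.mem_powerset]
    refine ⟨Finset.filter_subset _ _, ⟨x, by simp [hx]⟩, fun h => hxy ?_⟩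
    rw [← h] at hy
    exact (Finset.mem_filter.1 hy).2.symm

theorem pow_le_functionsOn {E : Finset α} {V : Submodule K (α → K)}
    (hV : V ≤ functionsOn K E) {t : ℕ} (ht : t ≠ 0) : V ^ t ≤ functionsOn K E := by
  obtain ⟨t, rfl⟩ := Nat.exists_eq_succ_of_ne_zero ht
  rw [pow_succ']
  exact mul_le_functionsOn hV

theorem NoCommonZero.pow {E : Finset α} {V : Submodule K (α → K)} (hV : NoCommonZero V E)
    (t : ℕ) : NoCommonZero (V ^ t) E := fun x hx => by
  obtain ⟨f, hf, hfx⟩ := hV x hx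
  exact ⟨f ^ t, Submodule.pow_mem_pow V hf t, by simpa using pow_ne_zero t hfx⟩

theorem Stabilizes.mul_right [DecidableEq α] {S : Finset α} {V : Submodule K (α → K)}
    (h : Stabilizes S V) (W : Submodule K (α → K)) : Stabilizes S (V * W) := fun f hf => by
  induction hf using Submodule.mul_induction_on' with
  | mem_mul_mem v hv w hw =>
    rw [← mul_assoc]
    exact Submodule.mul_mem_mul (h v hv) hw
  | add f _ g _ hf hg => rw [mul_add]; exact Submodule.add_mem _ hf hg

/-- Linear growth of the powers of `V`, as long as no proper part of `E` splits off. -/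
theorem mul_finrank_le_finrank_pow_add [Finite α] [Infinite K] [DecidableEq α]
    {E : Finset α}
    {V : Submodule K (α → K)} (hV : V ≤ functionsOn K E) (hV0 : NoCommonZero V E) (t : ℕ)
    (hno : ∀ S ⊆ E, S.Nonempty → S ≠ E → ¬ Stabilizes S (V ^ (t + 1))) :
    (t + 1) * finrank K V ≤ finrank K (V ^ (t + 1) : Submodule K (α → K)) + t := by
  induction t with
  | zero => simpa using Submodule.finrank_mono (pow_one V).ge
  | succ t ih =>
    have h₁ := ih fun S hS hne hSE hst => hno S hS hne hSE (by
      rw [pow_succ]; exact hst.mul_right V)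
    rcases finrank_add_finrank_le_or_exists_stabilizes
      (pow_le_functionsOn hV (t := t + 1) (by omega)) hV (hV0.pow (t + 1)) hV0 with
      h | ⟨S, hS, hne, hSE, hst⟩
    · rw [← pow_succ] at h
      rw [add_mul (t + 1) 1, one_mul]
      omega
    · rw [← pow_succ] at hst
      exact absurd hst (hno S hS hne hSE)

end ProductSpaces

/-! ### Spans of indicator functions and their powers. -/

section SetFamilies

variable {K α : Type*} [Field K] [DecidableEq α]

theorem ind_inter (A B : Finset α) : ind K (A ∩ B) = ind K A * ind K B := by
  funext x
  by_cases hA : x ∈ A <;> by_cases hB : x ∈ B <;> simp [ind, hA, hB]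

theorem ind_inter_add_ind_inter_compl [Fintype α] (A B : Finset α) :
    ind K (A ∩ B) + ind K (A ∩ Bᶜ) = ind K A := by
  funext x
  by_cases hA : x ∈ A <;> by_cases hB : x ∈ B <;> simp [ind, hA, hB]

theorem sum_ind [Fintype α] (A : Finset α) : ∑ x, ind K A x = (A.card : K) := by
  simp [ind]

/-- The space spanned by the indicator functions of the members of `F`. -/
def indSpan (K : Type*) {α : Type*} [Field K] [DecidableEq α] (F : Finset (Finset α)) :
    Submodule K (α → K) :=
  Submodule.span K (ind K '' (F : Set (Finset α)))

theorem ind_mem_indSpan {F : Finset (Finset α)} {A : Finset α} (hA : A ∈ F) :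
    ind K A ∈ indSpan K F :=
  Submodule.subset_span ⟨A, hA, rfl⟩

theorem indSpan_le {F : Finset (Finset α)} {V : Submodule K (α → K)}
    (h : ∀ A ∈ F, ind K A ∈ V) : indSpan K F ≤ V := by
  refine Submodule.span_le.2 ?_
  rintro _ ⟨A, hA, rfl⟩
  exact h A hA

theorem indSpan_le_functionsOn (F : Finset (Finset α)) :
    indSpan K F ≤ functionsOn K (F.sup id) :=
  indSpan_le fun _ hA _ hx => if_neg fun hxA => hx (Finset.le_sup (f := id) hA hxA)

theorem noCommonZero_indSpan (F : Finset (Finset α)) :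
    NoCommonZero (indSpan K F) (F.sup id) := fun x hx => by
  obtain ⟨A, hA, hxA⟩ := Finset.mem_sup.1 hx
  exact ⟨_, ind_mem_indSpan hA, by simpa [ind] using hxA⟩

theorem finrank_indSpan_le_card [Finite α] (F : Finset (Finset α)) :
    finrank K (indSpan K F) ≤ F.card := by
  classical
  have h := finrank_span_finset_le_card (R := K) (F.image (ind K))
  rw [Finset.coe_image] at h
  exact h.trans Finset.card_image_le

theorem finrank_functionsOn_le [Finite α] (E : Finset α) :
    finrank K (functionsOn K E) ≤ E.card := by
  have h : functionsOn K E ≤ indSpan K (E.image fun x => {x}) := by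
    intro f hf
    have : f = ∑ x ∈ E, f x • ind K {x} := by
      funext y
      by_cases hy : y ∈ E
      · simp [ind, Finset.sum_apply, hy]
      · simp [ind, Finset.sum_apply, hy, hf y hy]
    rw [this]
    exact Submodule.sum_mem _ fun x hx => Submodule.smul_mem _ _
      (ind_mem_indSpan (Finset.mem_image_of_mem _ hx))
  exact ((Submodule.finrank_mono h).trans (finrank_indSpan_le_card _)).trans Finset.card_image_le

/-- A `d`-dimensional affine space contains at most `2 ^ d` functions with values `0` and `1`. -/
theorem card_le_two_pow_finrank [Finite α] (V : Submodule K (α → K)) :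
    ∀ F : Finset (Finset α), (∀ A ∈ F, ∀ B ∈ F, ind K A - ind K B ∈ V) →
      F.card ≤ 2 ^ finrank K V := by
  induction hd : finrank K V using Nat.strong_induction_on generalizing V with
  | _ d ih =>
  intro F hF
  rcases le_or_gt F.card 1 with h | h
  · exact h.trans Nat.one_le_two_pow
  · obtain ⟨A, hA, B, hB, hAB⟩ := Finset.one_lt_card.1 h
    obtain ⟨x, hx⟩ : ∃ x, ¬ (x ∈ A ↔ x ∈ B) := by
      by_contra! hcon
      exact hAB (Finset.ext hcon)
    -- Sets containing `x` and sets avoiding `x` each have differences in `V₀`, a proper subspace.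
    set V₀ := V ⊓ LinearMap.ker (LinearMap.proj (R := K) (φ := fun _ : α => K) x) with hV₀
    have hlt : finrank K V₀ < d := by
      rw [← hd]
      refine Submodule.finrank_lt_finrank_of_lt (lt_of_le_of_ne inf_le_left fun he => ?_)
      have hmem : ind K A - ind K B ∈ V₀ := he ▸ hF A hA B hB
      have h0 : ind K A x - ind K B x = 0 := hmem.2
      by_cases hxA : x ∈ A <;> by_cases hxB : x ∈ B <;> simp_all [ind]
    have h₁ := ih _ hlt V₀ rfl (F.filter (x ∈ ·)) (by
      intro C hC D hD
      rw [Finset.mem_filter] at hC hD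
      exact ⟨hF C hC.1 D hD.1, by simp [ind, hC.2, hD.2]⟩)
    have h₂ := ih _ hlt V₀ rfl (F.filter (x ∉ ·)) (by
      intro C hC D hD
      rw [Finset.mem_filter] at hC hD
      exact ⟨hF C hC.1 D hD.1, by simp [ind, hC.2, hD.2]⟩)
    have h₃ := Finset.card_filter_add_card_filter_not (s := F) (x ∈ ·)
    have h₄ : 2 ^ (finrank K V₀ + 1) ≤ 2 ^ d := Nat.pow_le_pow_right (by omega) hlt
    rw [pow_succ] at h₄
    omega

/-- Indicators are idempotent. Exponent `0` is excluded because the constant `1` need not be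
supported on the union of `F`. -/
theorem indSpan_pow_mono (F : Finset (Finset α)) {s t : ℕ} (hs : s ≠ 0) (hst : s ≤ t) :
    indSpan K F ^ s ≤ indSpan K F ^ t := by
  have h : indSpan K F ≤ indSpan K F * indSpan K F := indSpan_le fun A hA => by
    have := Submodule.mul_mem_mul (ind_mem_indSpan (K := K) hA) (ind_mem_indSpan (K := K) hA)
    rwa [← ind_inter, Finset.inter_self] at this
  induction t, hst using Nat.le_induction with
  | base => exact le_rfl
  | succ t hst ih =>
    refine ih.trans ?_
    obtain ⟨t, rfl⟩ := Nat.exists_eq_succ_of_ne_zero (show t ≠ 0 by omega)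
    rw [pow_succ _ (t + 1), pow_succ, mul_assoc]
    exact mul_le_mul_right h _

theorem prod_ind_mem_indSpan_pow {F : Finset (Finset α)} {ι : Type*} (A : ι → Finset α)
    (hA : ∀ i, A i ∈ F) (S : Finset ι) :
    ∏ i ∈ S, ind K (A i) ∈ indSpan K F ^ S.card := by
  classical
  induction S using Finset.induction_on with
  | empty => simpa using ⟨1, map_one _⟩
  | insert i S hi ih =>
    rw [Finset.prod_insert hi, Finset.card_insert_of_notMem hi, pow_succ']
    exact Submodule.mul_mem_mul (ind_mem_indSpan (hA i)) ih

/-- If the product of `t` members is not a combination of shorter products, then its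
nonempty subproducts are linearly independent. -/
theorem linearIndependent_subproducts {F : Finset (Finset α)} {t : ℕ} (A : Fin (t + 1) → Finset α)
    (hA : ∀ i, A i ∈ F) (hprod : ∏ i, ind K (A i) ∉ indSpan K F ^ t) :
    LinearIndependent K
      fun S : {S : Finset (Fin (t + 1)) // S.Nonempty} => ∏ i ∈ S.1, ind K (A i) := by
  classical
  rw [Fintype.linearIndependent_iff]
  intro c hc
  by_contra! hcon
  -- Multiply the relation by the factors outside a largest `S` in its support: only the `S` term
  -- becomes the full product, and the others have at most `t` factors.
  obtain ⟨S, hS, hmax⟩ := Finset.exists_max_image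
    (Finset.univ.filter fun S => c S ≠ 0) (fun S => S.1.card)
    (by obtain ⟨S, hS⟩ := hcon; exact ⟨S, by simpa using hS⟩)
  simp only [Finset.mem_filter, Finset.mem_univ, true_and] at hS hmax
  have hmul : ∀ T : Finset (Fin (t + 1)),
      (∏ i ∈ T, ind K (A i)) * ∏ i ∈ S.1ᶜ, ind K (A i) = ∏ i ∈ T ∪ S.1ᶜ, ind K (A i) := by
    intro T
    funext x
    simp only [Pi.mul_apply, Finset.prod_apply, ind, Finset.prod_boole,
      ite_zero_mul_ite_zero, mul_one, Finset.mem_union]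
    refine if_congr ⟨?_, ?_⟩ rfl rfl
    · rintro ⟨h₁, h₂⟩ i (hi | hi)
      exacts [h₁ i hi, h₂ i hi]
    · exact fun h => ⟨fun i hi => h i (Or.inl hi), fun i hi => h i (Or.inr hi)⟩
  have hsum := congrArg (· * ∏ i ∈ S.1ᶜ, ind K (A i)) hc
  simp only [Finset.sum_mul, smul_mul_assoc, hmul, zero_mul] at hsum
  rw [← Finset.add_sum_erase _ _ (Finset.mem_univ S), Finset.union_compl] at hsum
  have hrest : ∑ T ∈ Finset.univ.erase S, c T • ∏ i ∈ T.1 ∪ S.1ᶜ, ind K (A i) ∈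
      indSpan K F ^ t := by
    refine Submodule.sum_mem _ fun T hT => ?_
    by_cases hcT : c T = 0
    · simp [hcT]
    refine Submodule.smul_mem _ _ (indSpan_pow_mono F ?_ ?_ (prod_ind_mem_indSpan_pow A hA _))
    · exact (T.2.mono Finset.subset_union_left).card_pos.ne'
    · by_contra! hlt
      have huniv : T.1 ∪ S.1ᶜ = Finset.univ :=
        Finset.eq_univ_of_card _ (le_antisymm (Finset.card_le_univ _) (by simpa using hlt))
      have hST : S.1 ⊆ T.1 := fun i hi => by
        have := huniv ▸ Finset.mem_univ i
        simpa [hi] using this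
      exact Finset.ne_of_mem_erase hT
        (Subtype.ext (Finset.eq_of_subset_of_card_le hST (hmax T hcT)).symm)
  refine hprod ((Submodule.smul_mem_iff _ hS).1 ?_)
  rw [eq_neg_of_add_eq_zero_left hsum]
  exact Submodule.neg_mem _ hrest

/-- The `2 ^ (t + 1) - 1` nonempty subproducts are independent functions supported on the union of
`F`. -/
theorem two_pow_le_card_add_one [Finite α] {F : Finset (Finset α)} {t : ℕ}
    (h : ¬ indSpan K F ^ (t + 1) ≤ indSpan K F ^ t) : 2 ^ (t + 1) ≤ (F.sup id).card + 1 := by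
  obtain ⟨A, hA, hprod⟩ : ∃ A : Fin (t + 1) → Finset α, (∀ i, A i ∈ F) ∧
      ∏ i, ind K (A i) ∉ indSpan K F ^ t := by
    by_contra! hcon
    apply h
    rw [indSpan, Submodule.span_pow, Submodule.span_le]
    intro f hf
    obtain ⟨g, rfl⟩ := Set.mem_pow.1 hf
    choose A hA hAg using fun i => (g i).2
    have := hcon A hA
    simp only [hAg] at this
    rwa [List.prod_ofFn]
  have hli := linearIndependent_subproducts A hA hprod
  have hle : Submodule.span K (Set.range
      fun S : {S : Finset (Fin (t + 1)) // S.Nonempty} => ∏ i ∈ S.1, ind K (A i)) ≤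
      functionsOn K (F.sup id) := by
    rw [Submodule.span_le]
    rintro _ ⟨S, rfl⟩
    exact pow_le_functionsOn (indSpan_le_functionsOn F) S.2.card_pos.ne'
      (prod_ind_mem_indSpan_pow A hA S.1)
  have h₁ := (Submodule.finrank_mono hle).trans (finrank_functionsOn_le _)
  rw [finrank_span_eq_card hli] at h₁
  have h₂ : Fintype.card {S : Finset (Fin (t + 1)) // S.Nonempty} + 1 = 2 ^ (t + 1) := by
    simp only [Finset.nonempty_iff_ne_empty]
    rw [Fintype.card_subtype_compl, Fintype.card_subtype_eq, Fintype.card_finset, Fintype.card_fin]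
    exact Nat.sub_add_cancel Nat.one_le_two_pow
  omega

end SetFamilies

/-! ### Splitting the ground set, and the dichotomy between atoms and small dimension. -/

section Divisibility

variable {K α : Type*} [Field K] [DecidableEq α]

/-- The traces of the members of `F` on `S`. -/
def restrictTo (F : Finset (Finset α)) (S : Finset α) : Finset (Finset α) :=
  F.image (· ∩ S)

theorem indSpan_le_sup_restrictTo [Fintype α] (F : Finset (Finset α)) (S : Finset α) :
    indSpan K F ≤ indSpan K (restrictTo F S) ⊔ indSpan K (restrictTo F Sᶜ) :=
  indSpan_le fun A hA => by
    rw [← ind_inter_add_ind_inter_compl A S]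
    exact Submodule.add_mem_sup (ind_mem_indSpan (Finset.mem_image_of_mem _ hA))
      (ind_mem_indSpan (Finset.mem_image_of_mem _ hA))

/-- This passes the zero-sum condition from `F` to its traces on `S`. -/
theorem indSpan_restrictTo_pow_le {F : Finset (Finset α)} {S : Finset α} (t : ℕ)
    (hS : Stabilizes S (indSpan K F ^ (t + 1))) :
    indSpan K (restrictTo F S) ^ (t + 1) ≤ indSpan K F ^ (t + 1) := by
  have hgen : indSpan K (restrictTo F S) ≤
      (indSpan K F).map (LinearMap.mulLeft K (ind K S)) := indSpan_le fun A hA => by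
    obtain ⟨B, hB, rfl⟩ := Finset.mem_image.1 hA
    exact ⟨_, ind_mem_indSpan hB, by rw [ind_inter, mul_comm]; rfl⟩
  have hpow : ∀ t : ℕ, indSpan K (restrictTo F S) ^ (t + 1) ≤
      (indSpan K F ^ (t + 1)).map (LinearMap.mulLeft K (ind K S)) := by
    intro t
    induction t with
    | zero => simpa only [zero_add, pow_one] using hgen
    | succ t ih =>
      rw [pow_succ, pow_succ _ (t + 1), Submodule.mul_le]
      intro f hf g hg
      obtain ⟨u, hu, rfl⟩ := ih hf
      obtain ⟨v, hv, rfl⟩ := hgen hg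
      refine ⟨u * v, Submodule.mul_mem_mul hu hv, ?_⟩
      have hid : ind K S * ind K S = ind K S := by rw [← ind_inter, Finset.inter_self]
      simp only [LinearMap.mulLeft_apply]
      rw [show ind K S * u * (ind K S * v) = ind K S * ind K S * (u * v) by ring, hid]
  intro f hf
  obtain ⟨g, hg, rfl⟩ := hpow t hf
  exact hS g hg

theorem Stabilizes.compl [Fintype α] {S : Finset α} {V : Submodule K (α → K)} (h : Stabilizes S V) :
    Stabilizes Sᶜ V := fun f hf => by
  have : ind K Sᶜ * f = f - ind K S * f := by
    funext x
    by_cases hx : x ∈ S <;> simp [ind, hx]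
  rw [this]
  exact V.sub_mem hf (h f hf)

/-- Every member of `F` is a union of some of the pairwise disjoint, nonempty sets `atoms`, whose
sizes are multiples of `p`. -/
def HasAtoms (p : ℕ) (F atoms : Finset (Finset α)) : Prop :=
  (∀ B ∈ atoms, ∀ C ∈ atoms, B ≠ C → Disjoint B C) ∧
    (∀ B ∈ atoms, B.Nonempty ∧ p ∣ B.card ∧ B ⊆ F.sup id) ∧
    ∀ A ∈ F, ∃ T ⊆ atoms, A = T.sup id

theorem HasAtoms.sum_card_le {p : ℕ} {F atoms : Finset (Finset α)} (h : HasAtoms p F atoms) :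
    ∑ B ∈ atoms, B.card ≤ (F.sup id).card := by
  have := Finset.card_biUnion (s := atoms) (t := id) fun B hB C hC hne => h.1 B hB C hC hne
  simp only [id] at this
  rw [← this]
  refine Finset.card_le_card fun x hx => ?_
  obtain ⟨B, hB, hxB⟩ := Finset.mem_biUnion.1 hx
  exact (h.2.1 B hB).2.2 hxB

theorem HasAtoms.mul_card_le {p : ℕ} {F atoms : Finset (Finset α)} (h : HasAtoms p F atoms) :
    p * atoms.card ≤ (F.sup id).card := by
  refine le_trans ?_ h.sum_card_le
  rw [mul_comm, ← smul_eq_mul]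
  exact Finset.card_nsmul_le_sum _ _ _ fun B hB =>
    Nat.le_of_dvd (h.2.1 B hB).1.card_pos (h.2.1 B hB).2.1

theorem HasAtoms.finrank_indSpan_le [Fintype α] {p : ℕ} {F atoms : Finset (Finset α)}
    (h : HasAtoms p F atoms) : finrank K (indSpan K F) ≤ atoms.card := by
  refine (Submodule.finrank_mono (indSpan_le fun A hA => ?_)).trans
    (finrank_indSpan_le_card (K := K) atoms)
  obtain ⟨T, hT, rfl⟩ := h.2.2 A hA
  have : ind K (T.sup id) = ∑ B ∈ T, ind K B := by
    funext x
    rw [Finset.sum_apply]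
    by_cases hx : x ∈ T.sup id
    · obtain ⟨B, hB, hxB⟩ := Finset.mem_sup.1 hx
      rw [Finset.sum_eq_single B]
      · simp only [ind, if_pos hx]
        exact (if_pos hxB).symm
      · intro C hC hne
        exact if_neg fun hxC =>
          Finset.disjoint_left.1 (h.1 C (hT hC) B (hT hB) hne) hxC hxB
      · exact fun hB' => absurd hB hB'
    · rw [Finset.sum_eq_zero]
      · exact if_neg hx
      · exact fun B hB => if_neg fun hxB => hx (Finset.mem_sup.2 ⟨B, hB, hxB⟩)
  rw [this]
  exact Submodule.sum_mem _ fun B hB => ind_mem_indSpan (hT hB)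

theorem HasAtoms.card_le {p : ℕ} {F atoms : Finset (Finset α)} (h : HasAtoms p F atoms) :
    F.card ≤ 2 ^ atoms.card := by
  have hsub : F ⊆ atoms.powerset.image fun T => T.sup id := fun A hA => by
    obtain ⟨T, hT, rfl⟩ := h.2.2 A hA
    exact Finset.mem_image_of_mem _ (Finset.mem_powerset.2 hT)
  exact (Finset.card_le_card hsub).trans (Finset.card_image_le.trans (Finset.card_powerset _).le)

theorem sup_restrictTo_subset (F : Finset (Finset α)) (S : Finset α) :
    (restrictTo F S).sup id ⊆ F.sup id ∩ S := by
  intro x hx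
  obtain ⟨B, hB, hxB⟩ := Finset.mem_sup.1 hx
  obtain ⟨A, hA, rfl⟩ := Finset.mem_image.1 hB
  have hx' := Finset.mem_inter.1 hxB
  exact Finset.mem_inter.2 ⟨Finset.mem_sup.2 ⟨A, hA, hx'.1⟩, hx'.2⟩

theorem card_sup_restrictTo_add_le [Fintype α] (F : Finset (Finset α)) (S : Finset α) :
    ((restrictTo F S).sup id).card + ((restrictTo F Sᶜ).sup id).card ≤ (F.sup id).card := by
  rw [← Finset.card_inter_add_card_sdiff (F.sup id) S, Finset.sdiff_eq_inter_compl]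
  exact add_le_add (Finset.card_le_card (sup_restrictTo_subset F S))
    (Finset.card_le_card (sup_restrictTo_subset F Sᶜ))

theorem HasAtoms.union [Fintype α] {p : ℕ} {F : Finset (Finset α)} {S : Finset α}
    {atoms atoms' : Finset (Finset α)} (h : HasAtoms p (restrictTo F S) atoms)
    (h' : HasAtoms p (restrictTo F Sᶜ) atoms') : HasAtoms p F (atoms ∪ atoms') := by
  have hS : ∀ B ∈ atoms, B ⊆ F.sup id ∩ S := fun B hB =>
    (h.2.1 B hB).2.2.trans (sup_restrictTo_subset F S)
  have hS' : ∀ B ∈ atoms', B ⊆ F.sup id ∩ Sᶜ := fun B hB =>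
    (h'.2.1 B hB).2.2.trans (sup_restrictTo_subset F Sᶜ)
  have hdisj : ∀ B ∈ atoms, ∀ C ∈ atoms', Disjoint B C := fun B hB C hC =>
    Finset.disjoint_of_subset_left ((hS B hB).trans Finset.inter_subset_right)
      (Finset.disjoint_of_subset_right ((hS' C hC).trans Finset.inter_subset_right)
        disjoint_compl_right)
  refine ⟨fun B hB C hC hne => ?_, fun B hB => ?_, fun A hA => ?_⟩
  · rcases Finset.mem_union.1 hB with hB | hB <;> rcases Finset.mem_union.1 hC with hC | hC
    · exact h.1 B hB C hC hne
    · exact hdisj B hB C hC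
    · exact (hdisj C hC B hB).symm
    · exact h'.1 B hB C hC hne
  · rcases Finset.mem_union.1 hB with hB | hB
    · exact ⟨(h.2.1 B hB).1, (h.2.1 B hB).2.1, (hS B hB).trans Finset.inter_subset_left⟩
    · exact ⟨(h'.2.1 B hB).1, (h'.2.1 B hB).2.1, (hS' B hB).trans Finset.inter_subset_left⟩
  · obtain ⟨T, hT, hAT⟩ := h.2.2 (A ∩ S) (Finset.mem_image_of_mem _ hA)
    obtain ⟨T', hT', hAT'⟩ := h'.2.2 (A ∩ Sᶜ) (Finset.mem_image_of_mem _ hA)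
    refine ⟨T ∪ T', Finset.union_subset_union hT hT', ?_⟩
    rw [Finset.sup_union, ← hAT, ← hAT']
    ext x
    by_cases hx : x ∈ S <;> simp [hx]

/-- If no proper part of the ground set splits off, the dimension is small compared to the
ground set. -/
theorem mul_finrank_add_le_of_forall_not_stabilizes [Fintype α] [Infinite K] {p : ℕ}
    {F : Finset (Finset α)}
    (hno : ∀ S ⊆ F.sup id, S.Nonempty → S ≠ F.sup id → ¬ Stabilizes S (indSpan K F ^ (p + 1)))
    {A : Finset α} (hA : A ∈ F) (hne : A.Nonempty) (hAE : A ≠ F.sup id) :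
    p * finrank K (indSpan K F) + p ≤ (F.sup id).card := by
  have hlin := mul_finrank_le_finrank_pow_add (indSpan_le_functionsOn F)
    (noCommonZero_indSpan F) p hno
  have hdim := (Submodule.finrank_mono (pow_le_functionsOn (indSpan_le_functionsOn (K := K) F)
    p.succ_ne_zero)).trans (finrank_functionsOn_le _)
  -- If the powers stopped growing at `p + 1`, multiplication by the indicator of `A` would preserve
  -- `V ^ (p + 1)`.
  have hexp : 2 ^ (p + 2) ≤ (F.sup id).card + 1 := by
    refine two_pow_le_card_add_one (K := K) fun hle => ?_
    refine hno A (Finset.le_sup (f := id) hA) hne hAE fun f hf => hle ?_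
    rw [pow_succ']
    exact Submodule.mul_mem_mul (ind_mem_indSpan hA) hf
  have harith : ∀ q : ℕ, 2 * (q * q) < 2 ^ (q + 2) := by
    intro q
    induction q with
    | zero => norm_num
    | succ q ih =>
      rcases Nat.lt_or_ge q 3 with h | h
      · interval_cases q <;> norm_num
      · rw [show q + 1 + 2 = (q + 2) + 1 by ring, pow_succ]
        nlinarith
  have := harith p
  rcases le_or_gt (2 * p) (finrank K (indSpan K F)) with h | h
  · rw [Nat.succ_eq_add_one] at hdim
    rw [add_mul, one_mul] at hlin
    omega
  · have : p * (finrank K (indSpan K F) + 1) ≤ p * (2 * p) := Nat.mul_le_mul_left p h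
    nlinarith

theorem exists_hasAtoms_or_mul_finrank_add_le [Fintype α] [Infinite K] (p : ℕ)
    [CharP K p]
    (F : Finset (Finset α)) (hF : ∀ f ∈ indSpan K F ^ (p + 1), ∑ x, f x = 0) :
    (∃ atoms, HasAtoms p F atoms) ∨
      p * finrank K (indSpan K F) + p ≤ (F.sup id).card := by
  induction hm : (F.sup id).card using Nat.strong_induction_on generalizing F with
  | _ m ih =>
  by_cases hsplit : ∃ S ⊆ F.sup id, S.Nonempty ∧ S ≠ F.sup id ∧
      Stabilizes S (indSpan K F ^ (p + 1))
  · obtain ⟨S, hSE, hne, hSne, hst⟩ := hsplit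
    have hcard := card_sup_restrictTo_add_le F S
    have hlt : ((restrictTo F S).sup id).card < m := by
      rw [← hm]
      refine Finset.card_lt_card (((sup_restrictTo_subset F S).trans
        Finset.inter_subset_right).trans_ssubset (hSE.ssubset_of_ne hSne))
    have hlt' : ((restrictTo F Sᶜ).sup id).card < m := by
      rw [← hm]
      refine Finset.card_lt_card ((sup_restrictTo_subset F Sᶜ).trans_ssubset ?_)
      refine Finset.inter_subset_left.ssubset_of_ne fun h => ?_
      obtain ⟨x, hx⟩ := hne
      have hx' := hSE hx
      rw [← h] at hx'
      exact Finset.mem_compl.1 (Finset.mem_inter.1 hx').2 hx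
    have hdim := (Submodule.finrank_mono (indSpan_le_sup_restrictTo (K := K) F S)).trans
      (Submodule.finrank_add_le_finrank_add_finrank _ _)
    have hmul := Nat.mul_le_mul_left p hdim
    rw [mul_add] at hmul
    -- A side with atoms still satisfies `p * dim ≤ size`, so a single side without atoms supplies
    -- the extra `p`.
    rcases ih _ hlt (restrictTo F S)
      (fun f hf => hF f (indSpan_restrictTo_pow_le p hst hf)) rfl with ⟨atoms, h⟩ | h
    · have h₁ := Nat.mul_le_mul_left p (h.finrank_indSpan_le (K := K))
      have h₂ := h.mul_card_le
      rcases ih _ hlt' (restrictTo F Sᶜ)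
        (fun f hf => hF f (indSpan_restrictTo_pow_le p hst.compl hf)) rfl with ⟨atoms', h'⟩ | h'
      · exact Or.inl ⟨_, h.union h'⟩
      · right
        omega
    · right
      rcases ih _ hlt' (restrictTo F Sᶜ)
        (fun f hf => hF f (indSpan_restrictTo_pow_le p hst.compl hf)) rfl with ⟨atoms', h'⟩ | h'
      · have h₁ := Nat.mul_le_mul_left p (h'.finrank_indSpan_le (K := K))
        have h₂ := h'.mul_card_le
        omega
      · omega
  · push Not at hsplit
    by_cases htriv : ∃ A ∈ F, A.Nonempty ∧ A ≠ F.sup id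
    · obtain ⟨A, hA, hne, hAE⟩ := htriv
      rw [← hm]
      exact Or.inr (mul_finrank_add_le_of_forall_not_stabilizes hsplit hA hne hAE)
    · left
      push Not at htriv
      -- The union is the only possible nonempty member; the filter leaves no atom when it is empty.
      refine ⟨({F.sup id} : Finset (Finset α)).filter Finset.Nonempty, ?_, ?_, ?_⟩
      · intro B hB C hC hne
        simp only [Finset.mem_filter, Finset.mem_singleton] at hB hC
        exact absurd (hB.1.trans hC.1.symm) hne
      · intro B hB
        simp only [Finset.mem_filter, Finset.mem_singleton] at hB
        obtain ⟨rfl, hne⟩ := hB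
        refine ⟨hne, ?_, subset_rfl⟩
        obtain ⟨x, hx⟩ := hne
        obtain ⟨A, hA, hxA⟩ := Finset.mem_sup.1 hx
        rw [← htriv A hA ⟨x, hxA⟩, ← CharP.cast_eq_zero_iff K p, ← sum_ind]
        refine hF _ (indSpan_pow_mono F one_ne_zero (by omega) ?_)
        rw [pow_one]
        exact ind_mem_indSpan hA
      · intro A hA
        rcases A.eq_empty_or_nonempty with rfl | hne
        · exact ⟨∅, Finset.empty_subset _, rfl⟩
        · have hAE := htriv A hA hne
          refine ⟨{A}, ?_, by simp⟩
          rw [Finset.singleton_subset_iff, Finset.mem_filter, Finset.mem_singleton]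
          exact ⟨hAE, hne⟩

theorem sum_eq_zero_of_mem_indSpan_pow [Fintype α] {p k : ℕ} [CharP K p] {F : Finset (Finset α)}
    (hF : ∀ A : Fin k → Finset α, (∀ i, A i ∈ F) → p ∣ (Finset.univ.inf A).card)
    {f : α → K} (hf : f ∈ indSpan K F ^ k) : ∑ x, f x = 0 := by
  rw [indSpan, Submodule.span_pow] at hf
  induction hf using Submodule.span_induction with
  | mem f hf =>
    obtain ⟨g, rfl⟩ := Set.mem_pow.1 hf
    choose A hA hAg using fun i => (g i).2
    have hprod : (List.ofFn fun i => (g i : α → K)).prod = ind K (Finset.univ.inf A) := by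
      rw [List.prod_ofFn]
      funext x
      simp only [← hAg, Finset.prod_apply, ind, Finset.prod_boole, Finset.mem_inf]
      congr
    rw [hprod, sum_ind, CharP.cast_eq_zero_iff K p]
    exact hF A hA
  | zero => simp
  | add f g _ _ hf hg => simp [Finset.sum_add_distrib, hf, hg]
  | smul c f _ hf => simp [← Finset.mul_sum, hf]

end Divisibility

/-! ### The main theorem. -/

theorem theorem2 {n p : ℕ} (hp : p.Prime) (F : Finset (Finset (Fin n)))
    (hF : IsWiseDivisible (p + 1) p F)
    (hcard : (2 : ℝ) ^ (((n / p : ℕ) : ℤ) - 1) < (F.card : ℝ)) :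
    ∃ G atoms : Finset (Finset (Fin n)),
      IsAtomicFamily G atoms ∧ (∀ A ∈ atoms, A.card = p) ∧ F ⊆ G := by
  classical
  have : Fact p.Prime := ⟨hp⟩
  -- Generic choices need an infinite field; divisibility needs characteristic `p`.
  let K := AlgebraicClosure (ZMod p)
  have hlarge : ∀ d : ℕ, F.card ≤ 2 ^ d → n / p ≤ d := by
    intro d hd
    have h₁ : (F.card : ℝ) ≤ (2 : ℝ) ^ (d : ℤ) := by exact_mod_cast hd
    have h₂ := (zpow_lt_zpow_iff_right₀ (one_lt_two (α := ℝ))).1 (hcard.trans_le h₁)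
    omega
  have hn : (F.sup id).card ≤ n := by simpa using Finset.card_le_univ (F.sup id)
  have hlt : n < p * (n / p + 1) := Nat.lt_mul_div_succ n hp.pos
  rcases exists_hasAtoms_or_mul_finrank_add_le (K := K) p F
    (fun f hf => sum_eq_zero_of_mem_indSpan_pow hF hf) with ⟨atoms, h⟩ | h
  · refine ⟨atoms.powerset.image fun T => T.sup id, atoms, ⟨h.1, fun S => ?_⟩, fun B hB => ?_,
      fun A hA => ?_⟩
    · simp [eq_comm]
    -- An atom of size at least `2p` would make the total size at least `p * (atoms.card + 1)`,
    -- which exceeds `n`.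
    · by_contra hne
      obtain ⟨c, hc⟩ := (h.2.1 B hB).2.1
      have hc2 : 2 ≤ c := by
        have := (h.2.1 B hB).1.card_pos
        rcases c with _ | _ | c
        · omega
        · exact absurd (by simpa using hc) hne
        · omega
      have hB2 : p * 2 ≤ B.card := hc ▸ Nat.mul_le_mul_left p hc2
      have hsum := h.sum_card_le
      rw [← Finset.add_sum_erase _ _ hB] at hsum
      have hrest : (atoms.erase B).card * p ≤ ∑ C ∈ atoms.erase B, C.card := by
        rw [← smul_eq_mul]
        refine Finset.card_nsmul_le_sum _ _ _ fun C hC => ?_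
        have := h.2.1 C (Finset.mem_of_mem_erase hC)
        exact Nat.le_of_dvd this.1.card_pos this.2.1
      have hce := Finset.card_erase_add_one hB
      have hge := hlarge _ h.card_le
      have hle : p * (n / p + 1) ≤ p * ((atoms.erase B).card + 2) :=
        Nat.mul_le_mul_left p (by omega)
      rw [mul_add p _ 2, mul_comm p (atoms.erase B).card] at hle
      omega
    · obtain ⟨T, hT, rfl⟩ := h.2.2 A hA
      exact Finset.mem_image_of_mem _ (Finset.mem_powerset.2 hT)
  · exfalso
    have hge := hlarge _ (card_le_two_pow_finrank (indSpan K F) F fun A hA B hB =>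
      Submodule.sub_mem _ (ind_mem_indSpan hA) (ind_mem_indSpan hB))
    have := Nat.mul_le_mul_left p hge
    rw [mul_add, mul_one] at hlt
    omega
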